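/- Let $M$ be a connected smooth manifold (Hausdorff, second countable, without boundary) of dimension $2n+1$, with a smooth Riemannian metric $g$, a smooth $(1,1)$-tensor field $\varphi$, a smooth vector field $\xi$ and a smooth 1-form $\eta$ forming an almost contact metric structure, i.e. for all vector fields $X,Y$ $$\varphi^2=-I+\eta\otimes\xi,\quad \eta(\xi)=1,\quad \eta\circ\varphi=0,\quad \varphi(\xi)=0,\quad \eta(X)=g(X,\xi),\quad g(\varphi X,\varphi Y)=g(X,Y)-\eta(X)\eta(Y).$$ Let $\nabla$ be the Levi-Civita connection of $g$, and suppose that $(M,\varphi,\xi,\eta,g)$ is a regular $f$-Kenmotsu manifold: $f\in C^\infty(M)$ is strictly positive, $df\wedge\eta=0$, $$(\nabla_X\varphi)(Y)=f\,\bigl(g(\varphi X,Y)\xi-\eta(Y)\varphi X\bigr)\quad\text{for all vector fields }X,Y,$$ and $f^2+\xi(f)$ vanishes nowhere on $M$. Let $R(X,Y)Z=\nabla_X\nabla_YZ-\nabla_Y\nabla_XZ-\nabla_{[X,Y]}Z$ be the curvature tensor and $S(Y,Z)=\operatorname{trace}(X\mapsto R(X,Y)Z)$ the Ricci tensor. If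 $M$ is Ricci-semisymmetric, i.e. $R\cdot S=0$, where $$(R(X,Y)\cdot S)(X_1,X_2)=-S(R(X,Y)X_1,X_2)-S(X_1,R(X,Y)X_2),$$ then $M$ is Einstein: there is a real constant $c$ with $S=c\,g$ on $M$. In particular, if $M$ is semisymmetric, i.e. $R\cdot R=0$ (where $R(X,Y)$ acts on the tensor $R$ as a derivation), then $M$ is Ricci-semisymmetric, and hence Einstein. -/

import Mathlib

open Bundle
open scoped Manifold ContDiff

noncomputable section

namespace FKenmotsu

variable {E : Type*} [NormedAddCommGroup E] [NormedSpace ℝ E] [FiniteDimensional ℝ E]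
  {H : Type*} [TopologicalSpace H] {I : ModelWithCorners ℝ E H}
  {M : Type*} [TopologicalSpace M] [ChartedSpace H M] [IsManifold I ∞ M]

instance (x : M) : FiniteDimensional ℝ (TangentSpace I x) :=
  inferInstanceAs (FiniteDimensional ℝ E)

/-- The value at `x` of `R(X, Y) Z = ∇_X ∇_Y Z - ∇_Y ∇_X Z - ∇_{[X, Y]} Z`, for vector
fields `X, Y, Z` (recall that `∇_X Z` at `x` is spelled `cov Z x (X x)`). -/
def curvatureField (cov : CovariantDerivative I E (TangentSpace I : M → Type _))
    (X Y Z : Π x : M, TangentSpace I x) (x : M) : TangentSpace I x :=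
  cov (fun y ↦ cov Z y (Y y)) x (X x) - cov (fun y ↦ cov Z y (X y)) x (Y x)
    - cov Z x (VectorField.mlieBracket I X Y x)

/-- The curvature tensor `R(u, v) w` on tangent vectors at `x`, computed on vector fields that
extend `u, v, w` smoothly near `x`. For a smooth connection it does not depend on the extensions. -/
def curvature (cov : CovariantDerivative I E (TangentSpace I : M → Type _)) (x : M)
    (u v w : TangentSpace I x) : TangentSpace I x :=
  curvatureField cov (FiberBundle.extend E u) (FiberBundle.extend E v) (FiberBundle.extend E w) x

section Metric

variable [RiemannianBundle (fun x : M ↦ TangentSpace I x)]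

/-- The Ricci tensor `S(v, w) = trace (u ↦ R(u, v) w)`, the trace being computed in an
orthonormal basis of the tangent space. -/
def ricci (cov : CovariantDerivative I E (TangentSpace I : M → Type _)) (x : M)
    (v w : TangentSpace I x) : ℝ :=
  ∑ i, inner ℝ (curvature cov x (stdOrthonormalBasis ℝ (TangentSpace I x) i) v w)
    (stdOrthonormalBasis ℝ (TangentSpace I x) i)

/-- `(R(u, v) · S)(a, b) = - S(R(u, v) a, b) - S(a, R(u, v) b)`. -/
def curvatureActRicci (cov : CovariantDerivative I E (TangentSpace I : M → Type _)) (x : M)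
    (u v a b : TangentSpace I x) : ℝ :=
  - ricci cov x (curvature cov x u v a) b - ricci cov x a (curvature cov x u v b)

/-- `(R(u, v) · R)(a, b) c`, where the endomorphism `R(u, v)` acts on tensors as a derivation. -/
def curvatureActCurvature (cov : CovariantDerivative I E (TangentSpace I : M → Type _)) (x : M)
    (u v a b c : TangentSpace I x) : TangentSpace I x :=
  curvature cov x u v (curvature cov x a b c) - curvature cov x (curvature cov x u v a) b c
    - curvature cov x a (curvature cov x u v b) c - curvature cov x a b (curvature cov x u v c)

/-- Ricci-semisymmetry: `R · S = 0`. -/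
def IsRicciSemisymmetric (cov : CovariantDerivative I E (TangentSpace I : M → Type _)) : Prop :=
  ∀ (x : M) (u v a b : TangentSpace I x), curvatureActRicci cov x u v a b = 0

/-- Semisymmetry: `R · R = 0`. -/
def IsSemisymmetric (cov : CovariantDerivative I E (TangentSpace I : M → Type _)) : Prop :=
  ∀ (x : M) (u v a b c : TangentSpace I x), curvatureActCurvature cov x u v a b c = 0

/-- The Einstein condition: `S = c g` with a constant `c`. -/
def IsEinstein (cov : CovariantDerivative I E (TangentSpace I : M → Type _)) : Prop :=
  ∃ c : ℝ, ∀ (x : M) (v w : TangentSpace I x), ricci cov x v w = c * inner ℝ v w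

/-- `cov` is the Levi-Civita connection of the metric: the smooth affine connection that is
torsion-free and for which the metric is parallel. -/
structure IsLeviCivita
    (cov : CovariantDerivative I E (TangentSpace I : M → Type _)) : Prop where
  smooth : CovariantDerivative.ContMDiffCovariantDerivative cov ∞
  torsion_free : cov.torsion = 0
  /-- `u ⟨Y, Z⟩ = ⟨∇_u Y, Z⟩ + ⟨Y, ∇_u Z⟩` -/
  metric : ∀ (x : M) (u : TangentSpace I x) (Y Z : Π x : M, TangentSpace I x),
    MDiffAt (T% Y) x → MDiffAt (T% Z) x →
    d% (fun y ↦ (inner ℝ (Y y) (Z y) : ℝ)) x u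
      = inner ℝ (cov Y x u) (Z x) + inner ℝ (Y x) (cov Z x u)

/-- A smooth almost contact metric structure `(φ, ξ, η, g)`, where `g` is the metric given by the
inner products on the tangent spaces. -/
structure IsAlmostContactMetric (φ : Π x : M, TangentSpace I x →L[ℝ] TangentSpace I x)
    (ξ : Π x : M, TangentSpace I x) (η : Π x : M, TangentSpace I x →L[ℝ] ℝ) : Prop where
  smooth_phi : ContMDiff I (I.prod 𝓘(ℝ, E →L[ℝ] E)) ∞
    (fun x ↦ TotalSpace.mk' (E →L[ℝ] E) (E := fun x : M ↦ TangentSpace I x →L[ℝ] TangentSpace I x)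
      x (φ x))
  smooth_xi : CMDiff ∞ (T% ξ)
  smooth_eta : ContMDiff I (I.prod 𝓘(ℝ, E →L[ℝ] ℝ)) ∞
    (fun x ↦ TotalSpace.mk' (E →L[ℝ] ℝ) (E := fun x : M ↦ TangentSpace I x →L[ℝ] ℝ) x (η x))
  phi_phi : ∀ (x : M) (u : TangentSpace I x), φ x (φ x u) = - u + η x u • ξ x
  eta_xi : ∀ x : M, η x (ξ x) = 1
  eta_phi : ∀ (x : M) (u : TangentSpace I x), η x (φ x u) = 0
  phi_xi : ∀ x : M, φ x (ξ x) = 0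
  eta_eq : ∀ (x : M) (u : TangentSpace I x), η x u = inner ℝ u (ξ x)
  inner_phi : ∀ (x : M) (u v : TangentSpace I x),
    inner ℝ (φ x u) (φ x v) = inner ℝ u v - η x u * η x v

/-- `(M, φ, ξ, η, g)` is an `f`-Kenmotsu manifold, where `cov` is the Levi-Civita connection. -/
structure IsFKenmotsu
    (cov : CovariantDerivative I E (TangentSpace I : M → Type _))
    (φ : Π x : M, TangentSpace I x →L[ℝ] TangentSpace I x)
    (ξ : Π x : M, TangentSpace I x) (η : Π x : M, TangentSpace I x →L[ℝ] ℝ)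
    (f : M → ℝ) : Prop where
  leviCivita : IsLeviCivita cov
  almostContact : IsAlmostContactMetric φ ξ η
  smooth_f : ContMDiff I 𝓘(ℝ, ℝ) ∞ f
  f_pos : ∀ x, 0 < f x
  /-- `df ∧ η = 0` -/
  df_wedge_eta : ∀ (x : M) (u v : TangentSpace I x), d% f x u * η x v - d% f x v * η x u = 0
  /-- `(∇_X φ) Y = f (g(φ X, Y) ξ - η(Y) φ X)`, where `(∇_X φ) Y = ∇_X (φ Y) - φ (∇_X Y)` -/
  deriv_phi : ∀ (x : M) (u : TangentSpace I x) (Y : Π x : M, TangentSpace I x),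
    MDiffAt (T% Y) x →
    cov (fun y ↦ φ y (Y y)) x u - φ x (cov Y x u)
      = f x • (inner ℝ (φ x u) (Y x) • ξ x - η x (Y x) • φ x u)

/-- An `f`-Kenmotsu manifold is regular if `f² + ξ(f)` vanishes nowhere. -/
structure IsRegularFKenmotsu
    (cov : CovariantDerivative I E (TangentSpace I : M → Type _))
    (φ : Π x : M, TangentSpace I x →L[ℝ] TangentSpace I x)
    (ξ : Π x : M, TangentSpace I x) (η : Π x : M, TangentSpace I x →L[ℝ] ℝ)
    (f : M → ℝ) : Prop extends IsFKenmotsu cov φ ξ η f where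
  regular : ∀ x, f x ^ 2 + d% f x (ξ x) ≠ 0

end Metric

end FKenmotsu

end

/-! Put `k = f² + ξ(f)` and let `N` be the dimension. Applying `(∇_X φ)` to `ξ` gives `∇_X ξ = f (X
- η(X) ξ)` (`cov_xi`). Since `df = ξ(f) η`, differentiating once more yields `R(X,Y)ξ = k (η(X) Y -
η(Y) X)` (`curvature_xi`), so in the direction of `ξ` the curvature looks like that of a space form.
Hence `S(·,ξ) = (1 - N) k η`, and evaluating `(R(ξ,w)·S)(v,ξ) = 0` and dividing by `k ≠ 0` gives `S
= (1 - N) k g` (`ricciForm_eq_of_ricciSemisymmetric`).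

It remains to see that the factor is constant. This is Schur's lemma
(`mvfderiv_eq_zero_of_ricci_eq`): the doubly contracted second Bianchi identity says that `N - 2`
times its differential vanishes, and `N` is odd; connectedness concludes. Semisymmetry implies
Ricci-semisymmetry because the trace of a commutator is zero.

Tensor identities are proved for globally smooth fields and transported to tangent vectors by
`curvature_apply`. -/

noncomputable section

namespace FKenmotsu

open VectorField Filter Topology

set_option linter.unusedSectionVars false

/-! ### Global smooth fields and tensoriality -/

section Fields

variable {E : Type*} [NormedAddCommGroup E] [NormedSpace ℝ E] [FiniteDimensional ℝ E]
  {H : Type*} [TopologicalSpace H] {I : ModelWithCorners ℝ E H}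
  {M : Type*} [TopologicalSpace M] [ChartedSpace H M] [IsManifold I ∞ M]

variable (I M) in
/-- Globally defined smooth vector fields. -/
abbrev SmoothField := ContMDiffSection I E ∞ (TangentSpace I : M → Type _)

variable (I M) in
/-- Globally defined smooth real functions. -/
abbrev SmoothFun := ContMDiffMap I 𝓘(ℝ, ℝ) M ℝ ∞

instance : SMul (SmoothFun I M) (SmoothField I M) :=
  ⟨fun f X ↦ ⟨(f : M → ℝ) • (X : Π x : M, TangentSpace I x),
    f.contMDiff.smul_section X.contMDiff⟩⟩

@[simp]
lemma coe_fun_smul (f : SmoothFun I M) (X : SmoothField I M) :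
    ⇑(f • X) = (f : M → ℝ) • (X : Π x : M, TangentSpace I x) := rfl

lemma SmoothFun.mdiffAt (f : SmoothFun I M) (x : M) : MDiffAt (f : M → ℝ) x :=
  (f.contMDiff x).mdifferentiableAt (by simp)

lemma SmoothField.mdiffAt (X : SmoothField I M) (x : M) :
    MDiffAt (T% (X : Π x : M, TangentSpace I x)) x :=
  X.mdifferentiableAt

lemma contMDiff_mvfderiv_apply {f : M → ℝ} (hf : ContMDiff I 𝓘(ℝ, ℝ) ∞ f)
    (X : SmoothField I M) :
    ContMDiff I 𝓘(ℝ, ℝ) ∞ (fun x ↦ d% f x (X x)) := by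
  have h := (contMDiff_snd_tangentBundle_modelSpace ℝ 𝓘(ℝ, ℝ) (n := ∞)).comp
    ((hf.contMDiff_tangentMap (m := ∞) (by simp)).comp X.contMDiff)
  exact h

/-- The derivative of a smooth function along a smooth vector field. -/
def SmoothField.deriv (X : SmoothField I M) (f : SmoothFun I M) : SmoothFun I M :=
  ⟨fun x ↦ d% (f : M → ℝ) x (X x), contMDiff_mvfderiv_apply f.contMDiff X⟩

@[simp]
lemma SmoothField.deriv_apply (X : SmoothField I M) (f : SmoothFun I M) (x : M) :
    X.deriv f x = d% (f : M → ℝ) x (X x) := rfl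

lemma exists_smoothFun_bump [T2Space M] {x : M} {u : Set M} (hu : u ∈ 𝓝 x) :
    ∃ ρ : SmoothFun I M, tsupport ρ ⊆ u ∧ ∀ᶠ y in 𝓝 x, ρ y = 1 := by
  obtain ⟨ρ, hρ, -⟩ := (SmoothBumpFunction.nhds_basis_support (I := I) hu).mem_iff.mp hu
  exact ⟨⟨ρ, ρ.contMDiff⟩, hρ, ρ.eventuallyEq_one⟩

/-- A cutoff makes a local field global without changing its germ at `x`, so derivatives at `x` are
unaffected. -/
lemma exists_smoothField_eventuallyEq [T2Space M] {x : M} {u : Set M} (hu : u ∈ 𝓝 x)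
    {Z : Π x : M, TangentSpace I x} (hZ : CMDiff[u] ∞ (T% Z)) :
    ∃ X : SmoothField I M, ∀ᶠ y in 𝓝 x, X y = Z y := by
  obtain ⟨ρ, hρ, h1⟩ := exists_smoothFun_bump (I := I) (interior_mem_nhds.mpr hu)
  refine ⟨⟨(ρ : M → ℝ) • Z, ContMDiffOn.smul_section_of_tsupport ρ.contMDiff.contMDiffOn
    isOpen_interior hρ (hZ.mono interior_subset)⟩, ?_⟩
  filter_upwards [h1] with y hy
  simp [hy]

lemma exists_smoothField_eventuallyEq_extend [T2Space M] {x : M} (v : TangentSpace I x) :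
    ∃ X : SmoothField I M, ∀ᶠ y in 𝓝 x, X y = FiberBundle.extend E v y := by
  obtain ⟨s, hs, h⟩ := FiberBundle.exists_contMDiffOn_extend (k := ∞) I E v
  exact exists_smoothField_eventuallyEq hs h

lemma exists_smoothField_apply_eq [T2Space M] {x : M} (v : TangentSpace I x) :
    ∃ X : SmoothField I M, X x = v := by
  obtain ⟨X, h⟩ := exists_smoothField_eventuallyEq_extend v
  exact ⟨X, by simpa using h.self_of_nhds⟩

lemma eventually_mdiffAt_of_eventuallyEq (X : SmoothField I M) {x : M}
    {Z : Π x : M, TangentSpace I x} (h : ∀ᶠ y in 𝓝 x, X y = Z y) :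
    ∀ᶠ y in 𝓝 x, MDiffAt (T% Z) y := by
  filter_upwards [eventually_eventually_nhds.mpr h] with y hy
  exact (X.mdiffAt y).congr_of_eventuallyEq (hy.mono fun z hz ↦ by simp [hz])

/-- A `C^∞`-linear operation on smooth vector fields only depends on the value of the field. -/
lemma eq_zero_of_tensorial [T2Space M] {A : Type*} [AddCommGroup A] [Module ℝ A] {x : M}
    (Φ : SmoothField I M →+ A) (hΦ : ∀ (f : SmoothFun I M) X, Φ (f • X) = f x • Φ X)
    {X : SmoothField I M} (hX : X x = 0) : Φ X = 0 := by
  let t := trivializationAt E (TangentSpace I : M → Type _) x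
  have hx : x ∈ t.baseSet := FiberBundle.mem_baseSet_trivializationAt E _ x
  let b := Module.finBasis ℝ E
  obtain ⟨ρ, hρ, h1⟩ := exists_smoothFun_bump (I := I) (t.open_baseSet.mem_nhds hx)
  have hρx : ρ x = 1 := h1.self_of_nhds
  let e (i) : SmoothField I M := ⟨(ρ : M → ℝ) • t.localFrame b i,
    ContMDiffOn.smul_section_of_tsupport ρ.contMDiff.contMDiffOn t.open_baseSet hρ
      (t.contMDiffOn_localFrame_baseSet ∞ b i)⟩
  let c (i) : SmoothFun I M := ⟨fun y ↦ ρ y • t.localFrameCoeff I b i y (X y), by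
    refine contMDiff_of_tsupport fun y hy ↦ ?_
    have hy' : y ∈ t.baseSet := hρ (tsupport_smul_subset_left _ _ hy)
    exact (ρ.contMDiff y).smul (contMDiffAt_localFrameCoeff b hy' (X.contMDiff y) i)⟩
  -- The cutoff enters twice: one factor makes the coefficients global, the other the frame fields.
  -- As `ρ x = 1`, applying `Φ` recovers `Φ X`, while every `c i` vanishes at `x`.
  have key : (ρ * ρ) • X = ∑ i, c i • e i := by
    ext y
    have hs : (∑ i, c i • e i) y = ∑ i, c i y • e i y := by
      have := congrFun (map_sum (ContMDiffSection.coeAddHom I E ∞ (TangentSpace I : M → Type _))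
        (fun i ↦ c i • e i) Finset.univ) y
      simpa only [ContMDiffSection.coeAddHom_apply, Finset.sum_apply, coe_fun_smul,
        Pi.smul_apply'] using this
    rw [hs]
    by_cases hy : y ∈ t.baseSet
    · have := t.eq_sum_localFrameCoeff_smul (I := I) (s := X) (b := b) hy
      simp only [coe_fun_smul, Pi.smul_apply']
      conv_lhs => rw [this]
      rw [Finset.smul_sum]
      refine Finset.sum_congr rfl fun i _ ↦ ?_
      simp [c, e, smul_smul]
      ring_nf
    · have : ρ y = 0 := by
        by_contra h
        exact hy (hρ (subset_tsupport _ h))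
      simp [c, e, this]
  have h2 := congrArg Φ key
  rw [hΦ, map_sum] at h2
  have hc (i) : c i x = 0 := by simp [c, hX]
  simpa [hΦ, hρx, hc] using h2

end Fields

/-! ### Curvature of smooth fields and the Bianchi identities -/

section Connection

variable {E : Type*} [NormedAddCommGroup E] [NormedSpace ℝ E] [FiniteDimensional ℝ E]
  {H : Type*} [TopologicalSpace H] {I : ModelWithCorners ℝ E H}
  {M : Type*} [TopologicalSpace M] [ChartedSpace H M] [IsManifold I ∞ M]
  [RiemannianBundle (fun x : M ↦ TangentSpace I x)]
  {cov : CovariantDerivative I E (TangentSpace I : M → Type _)}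

namespace IsLeviCivita

/-- The Levi-Civita derivative `∇_X Z` of smooth vector fields, as a smooth vector field. -/
def nabla (hc : IsLeviCivita cov) (X Z : SmoothField I M) : SmoothField I M :=
  ⟨fun x ↦ cov Z x (X x), by
    have h := hc.smooth.contMDiff.contMDiff (σ := Z) (by simpa using Z.contMDiff.contMDiffOn)
    exact (contMDiffOn_univ.mp h).clm_bundle_apply X.contMDiff⟩

variable (hc : IsLeviCivita cov)

@[simp]
lemma nabla_apply (X Z : SmoothField I M) (x : M) : hc.nabla X Z x = cov Z x (X x) := rfl

lemma nabla_add_left (X Y Z : SmoothField I M) :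
    hc.nabla (X + Y) Z = hc.nabla X Z + hc.nabla Y Z := by
  ext x; simp

lemma nabla_sub_left (X Y Z : SmoothField I M) :
    hc.nabla (X - Y) Z = hc.nabla X Z - hc.nabla Y Z := by
  ext x; simp

lemma nabla_fun_smul_left (f : SmoothFun I M) (X Z : SmoothField I M) :
    hc.nabla (f • X) Z = f • hc.nabla X Z := by
  ext x; simp

lemma nabla_add_right (X Y Z : SmoothField I M) :
    hc.nabla X (Y + Z) = hc.nabla X Y + hc.nabla X Z := by
  ext x
  have := cov.isCovariantDerivativeOnUniv.add (Y.mdiffAt x) (Z.mdiffAt x)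
  simp [this]

/-- `∇_X` as an additive map. -/
def nablaHom (X : SmoothField I M) : SmoothField I M →+ SmoothField I M :=
  AddMonoidHom.mk' (hc.nabla X) (hc.nabla_add_right X)

lemma nabla_sub_right (X Y Z : SmoothField I M) :
    hc.nabla X (Y - Z) = hc.nabla X Y - hc.nabla X Z :=
  map_sub (hc.nablaHom X) Y Z

lemma nabla_fun_smul_right (X : SmoothField I M) (f : SmoothFun I M) (Z : SmoothField I M) :
    hc.nabla X (f • Z) = f • hc.nabla X Z + X.deriv f • Z := by
  ext x
  have := cov.isCovariantDerivativeOnUniv.leibniz (Z.mdiffAt x) (f.mdiffAt x)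
  simp [this]

/-- The Lie bracket of smooth vector fields, expressed through the connection. -/
def bracket (X Y : SmoothField I M) : SmoothField I M := hc.nabla X Y - hc.nabla Y X

lemma bracket_apply (X Y : SmoothField I M) (x : M) :
    hc.bracket X Y x = mlieBracket I X Y x := by
  rw [← (cov.torsion_eq_zero_iff.mp hc.torsion_free) (X.mdiffAt x) (Y.mdiffAt x)]
  simp [bracket]

lemma coe_bracket (X Y : SmoothField I M) :
    ⇑(hc.bracket X Y) = mlieBracket I (X : Π x : M, TangentSpace I x) Y :=
  funext (hc.bracket_apply X Y)

lemma leibniz_bracket (X Y Z : SmoothField I M) :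
    hc.bracket X (hc.bracket Y Z) =
      hc.bracket (hc.bracket X Y) Z + hc.bracket Y (hc.bracket X Z) := by
  have h (X : SmoothField I M) : CMDiff (minSmoothness ℝ 2) (T% (X : Π x : M, TangentSpace I x)) :=
    X.contMDiff.of_le (by simpa using (ENat.LEInfty.out : (2 : ℕ∞ω) ≤ ∞))
  have : IsManifold I (minSmoothness ℝ 3) M :=
    IsManifold.of_le (n := ∞) (by simpa using (ENat.LEInfty.out : (3 : ℕ∞ω) ≤ ∞))
  ext x
  simp only [coe_bracket, ContMDiffSection.coe_add]
  rw [leibniz_identity_mlieBracket (h X) (h Y) (h Z)]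

lemma bracket_add_right (X Y Z : SmoothField I M) :
    hc.bracket X (Y + Z) = hc.bracket X Y + hc.bracket X Z := by
  simp only [bracket, nabla_add_left, nabla_add_right]; abel

lemma bracket_fun_smul_right (X : SmoothField I M) (f : SmoothFun I M) (Y : SmoothField I M) :
    hc.bracket X (f • Y) = f • hc.bracket X Y + X.deriv f • Y := by
  simp only [bracket, nabla_fun_smul_left, nabla_fun_smul_right]
  ext x
  simp
  module

/-- Expand the Jacobi identity for `X, Y, f • Z` by the Leibniz rule and subtract `f` times the one
for `X, Y, Z`: what survives is the difference of the two sides times `Z`. Choosing `Z x ≠ 0`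
concludes; over a zero tangent space all derivatives vanish. -/
lemma deriv_bracket [T2Space M] (X Y : SmoothField I M) (f : SmoothFun I M) :
    (hc.bracket X Y).deriv f = X.deriv (Y.deriv f) - Y.deriv (X.deriv f) := by
  ext x
  by_cases hx : ∀ v : TangentSpace I x, v = 0
  · have h (Z : SmoothField I M) (g : SmoothFun I M) : Z.deriv g x = 0 := by simp [hx (Z x)]
    simp [-SmoothField.deriv_apply, h]
  · push Not at hx
    obtain ⟨v, hv⟩ := hx
    obtain ⟨Z, rfl⟩ := exists_smoothField_apply_eq v
    have h := congrArg (fun W : SmoothField I M ↦ W x) (hc.leibniz_bracket X Y (f • Z))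
    have h' := congrArg (fun W : SmoothField I M ↦ W x) (hc.leibniz_bracket X Y Z)
    simp only [bracket_fun_smul_right, bracket_add_right, ContMDiffSection.coe_add, Pi.add_apply,
      coe_fun_smul, Pi.smul_apply'] at h h'
    rw [h'] at h
    have h2 : ((hc.bracket X Y).deriv f x - (X.deriv (Y.deriv f) x - Y.deriv (X.deriv f) x)) • Z x
        = 0 := by
      linear_combination (norm := module) -h
    rcases smul_eq_zero.mp h2 with h3 | h3
    · exact sub_eq_zero.mp h3
    · exact absurd h3 hv

/-- The curvature `R(X, Y) Z` of smooth vector fields, as a smooth vector field. -/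
def curv (X Y Z : SmoothField I M) : SmoothField I M :=
  hc.nabla X (hc.nabla Y Z) - hc.nabla Y (hc.nabla X Z) - hc.nabla (hc.bracket X Y) Z

lemma curv_apply (X Y Z : SmoothField I M) (x : M) :
    hc.curv X Y Z x = curvatureField cov X Y Z x := by
  have h : hc.nabla (hc.bracket X Y) Z x = cov Z x (mlieBracket I X Y x) := by
    rw [nabla_apply, bracket_apply]
  simp only [curv, ContMDiffSection.coe_sub, Pi.sub_apply, h]
  rfl

lemma curv_swap (X Y Z : SmoothField I M) : hc.curv Y X Z = -hc.curv X Y Z := by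
  simp only [curv, bracket, nabla_sub_left]; abel

lemma curv_add_left (X X' Y Z : SmoothField I M) :
    hc.curv (X + X') Y Z = hc.curv X Y Z + hc.curv X' Y Z := by
  simp only [curv, bracket, nabla_sub_left, nabla_add_left, nabla_add_right]; abel

lemma curv_add_right (X Y Z Z' : SmoothField I M) :
    hc.curv X Y (Z + Z') = hc.curv X Y Z + hc.curv X Y Z' := by
  simp only [curv, nabla_add_right]; abel

lemma curv_fun_smul_left (f : SmoothFun I M) (X Y Z : SmoothField I M) :
    hc.curv (f • X) Y Z = f • hc.curv X Y Z := by
  ext x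
  simp only [curv, bracket, nabla_sub_left, nabla_fun_smul_left, nabla_fun_smul_right,
    nabla_add_left, ContMDiffSection.coe_add, ContMDiffSection.coe_sub, Pi.add_apply, Pi.sub_apply,
    coe_fun_smul, Pi.smul_apply']
  module

lemma curv_fun_smul_right [T2Space M] (f : SmoothFun I M) (X Y Z : SmoothField I M) :
    hc.curv X Y (f • Z) = f • hc.curv X Y Z := by
  ext x
  have h : (hc.bracket X Y).deriv f x = X.deriv (Y.deriv f) x - Y.deriv (X.deriv f) x := by
    rw [deriv_bracket]; rfl
  simp only [curv, nabla_fun_smul_right, nabla_add_right,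
    ContMDiffSection.coe_add, ContMDiffSection.coe_sub, Pi.add_apply, Pi.sub_apply,
    coe_fun_smul, Pi.smul_apply', h]
  module

/-- First Bianchi identity. -/
lemma curv_cyclic (X Y Z : SmoothField I M) :
    hc.curv X Y Z + hc.curv Y Z X + hc.curv Z X Y = 0 := by
  -- With `[X,Y] = ∇_X Y - ∇_Y X` substituted everywhere, the cyclic sum is literally the Jacobi
  -- identity.
  have h := hc.leibniz_bracket X Y Z
  simp only [curv, bracket, nabla_sub_left, nabla_sub_right] at h ⊢
  refine sub_eq_zero.mp (Eq.trans ?_ (sub_eq_zero.mpr h))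
  abel

/-- Second Bianchi identity. -/
lemma nabla_curv_cyclic (X Y Z U : SmoothField I M) :
    hc.nabla Z (hc.curv X Y U) + hc.nabla X (hc.curv Y Z U) + hc.nabla Y (hc.curv Z X U)
      = hc.curv Z X (hc.nabla Y U) + hc.curv X Y (hc.nabla Z U) + hc.curv Y Z (hc.nabla X U)
        + hc.curv (hc.bracket Z X) Y U + hc.curv (hc.bracket X Y) Z U
        + hc.curv (hc.bracket Y Z) X U := by
  -- The threefold derivatives of `U` cancel cyclically; the remainder is `∇_J U`, with `J` the
  -- Jacobi expression in `X, Y, Z`.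
  have h := congrArg (hc.nabla · U) (hc.leibniz_bracket X Y Z)
  simp only [curv, bracket, nabla_sub_left, nabla_sub_right, nabla_add_left] at h ⊢
  refine sub_eq_zero.mp (Eq.trans ?_ (sub_eq_zero.mpr h.symm))
  abel

end IsLeviCivita

end Connection

/-! ### The curvature tensor at a point -/

section Metric

variable {E : Type*} [NormedAddCommGroup E] [NormedSpace ℝ E] [FiniteDimensional ℝ E]
  {H : Type*} [TopologicalSpace H] {I : ModelWithCorners ℝ E H}
  {M : Type*} [TopologicalSpace M] [ChartedSpace H M] [IsManifold I ∞ M]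
  [RiemannianBundle (fun x : M ↦ TangentSpace I x)]
  {cov : CovariantDerivative I E (TangentSpace I : M → Type _)}

lemma SmoothField.deriv_add (X : SmoothField I M) (f g : SmoothFun I M) :
    X.deriv (f + g) = X.deriv f + X.deriv g := by
  ext x
  simp [mvfderiv_add (f.mdiffAt x) (g.mdiffAt x)]

/-- Curvature depends only on germs, so the merely local extensions in `curvature` may be replaced
by global smooth fields. -/
lemma curvatureField_congr (hc : IsLeviCivita cov) (X Y Z : SmoothField I M) {x : M}
    {U V W : Π x : M, TangentSpace I x} (hU : ∀ᶠ y in 𝓝 x, X y = U y)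
    (hV : ∀ᶠ y in 𝓝 x, Y y = V y) (hW : ∀ᶠ y in 𝓝 x, Z y = W y) :
    curvatureField cov U V W x = curvatureField cov X Y Z x := by
  have hcov := cov.isCovariantDerivativeOnUniv
  have h1 : ∀ᶠ y in 𝓝 x, cov Z y = cov W y := by
    filter_upwards [eventually_eventually_nhds.mpr hW,
      eventually_mdiffAt_of_eventuallyEq Z hW] with y hy hy'
    exact hcov.congr_of_eventuallyEq (Z.mdiffAt y) hy' univ_mem hy
  have h2 {X : SmoothField I M} {U : Π x : M, TangentSpace I x}
      (hU : ∀ᶠ y in 𝓝 x, X y = U y) :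
      cov (fun y ↦ cov W y (U y)) x = cov (fun y ↦ cov Z y (X y)) x := by
    have h3 : ∀ᶠ y in 𝓝 x, hc.nabla X Z y = cov W y (U y) := by
      filter_upwards [h1, hU] with y hy hy'
      simp [hy, hy']
    exact (hcov.congr_of_eventuallyEq ((hc.nabla X Z).mdiffAt x)
      (eventually_mdiffAt_of_eventuallyEq _ h3).self_of_nhds univ_mem h3).symm
  have h4 : mlieBracket I U V x = mlieBracket I X Y x := by
    refine (EventuallyEq.mlieBracket_vectorField_eq ?_ ?_).symm
    exacts [hU, hV]
  simp only [curvatureField, h2 hU, h2 hV, h4, h1.self_of_nhds, hU.self_of_nhds, hV.self_of_nhds]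

namespace IsLeviCivita

variable (hc : IsLeviCivita cov)

lemma curv_congr_left [T2Space M] {X X' : SmoothField I M} (Y Z : SmoothField I M) {x : M}
    (h : X x = X' x) : hc.curv X Y Z x = hc.curv X' Y Z x := by
  let Φ : SmoothField I M →+ TangentSpace I x :=
    AddMonoidHom.mk' (fun X ↦ hc.curv X Y Z x) fun X X' ↦ by rw [curv_add_left]; rfl
  have := eq_zero_of_tensorial (x := x) Φ (fun f X ↦ by
    change hc.curv (f • X) Y Z x = f x • hc.curv X Y Z x
    rw [curv_fun_smul_left]; rfl) (X := X - X') (by simp [h])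
  rw [map_sub, sub_eq_zero] at this
  exact this

lemma curv_congr_right [T2Space M] (X Y : SmoothField I M) {Z Z' : SmoothField I M} {x : M}
    (h : Z x = Z' x) : hc.curv X Y Z x = hc.curv X Y Z' x := by
  let Φ : SmoothField I M →+ TangentSpace I x :=
    AddMonoidHom.mk' (fun Z ↦ hc.curv X Y Z x) fun Z Z' ↦ by rw [curv_add_right]; rfl
  have := eq_zero_of_tensorial (x := x) Φ (fun f X ↦ by
    change hc.curv _ _ (f • X) x = f x • hc.curv _ _ X x
    rw [curv_fun_smul_right]; rfl) (X := Z - Z') (by simp [h])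
  rw [map_sub, sub_eq_zero] at this
  exact this

lemma curv_congr [T2Space M] {X X' Y Y' Z Z' : SmoothField I M} {x : M}
    (hX : X x = X' x) (hY : Y x = Y' x) (hZ : Z x = Z' x) :
    hc.curv X Y Z x = hc.curv X' Y' Z' x := by
  rw [hc.curv_congr_right X Y hZ, hc.curv_congr_left Y Z' hX, curv_swap,
    ContMDiffSection.coe_neg, Pi.neg_apply, hc.curv_congr_left X' Z' hY, curv_swap,
    ContMDiffSection.coe_neg, Pi.neg_apply, neg_neg]

/-- Locality passes to global extensions and tensoriality removes their choice. Every pointwise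
symmetry below is read off from fields through this bridge. -/
lemma curvature_apply [T2Space M] (X Y Z : SmoothField I M) (x : M) :
    curvature cov x (X x) (Y x) (Z x) = hc.curv X Y Z x := by
  obtain ⟨U, hU⟩ := exists_smoothField_eventuallyEq_extend (X x)
  obtain ⟨V, hV⟩ := exists_smoothField_eventuallyEq_extend (Y x)
  obtain ⟨W, hW⟩ := exists_smoothField_eventuallyEq_extend (Z x)
  rw [curvature, curvatureField_congr hc U V W hU hV hW, ← curv_apply]
  exact hc.curv_congr (by simpa using hU.self_of_nhds) (by simpa using hV.self_of_nhds)
    (by simpa using hW.self_of_nhds)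

include hc in
lemma curvature_swap [T2Space M] (x : M) (u v w : TangentSpace I x) :
    curvature cov x v u w = -curvature cov x u v w := by
  obtain ⟨X, rfl⟩ := exists_smoothField_apply_eq u
  obtain ⟨Y, rfl⟩ := exists_smoothField_apply_eq v
  obtain ⟨Z, rfl⟩ := exists_smoothField_apply_eq w
  rw [hc.curvature_apply, hc.curvature_apply, curv_swap]; rfl

include hc in
lemma curvature_add_left [T2Space M] (x : M) (u u' v w : TangentSpace I x) :
    curvature cov x (u + u') v w = curvature cov x u v w + curvature cov x u' v w := by
  obtain ⟨X, rfl⟩ := exists_smoothField_apply_eq u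
  obtain ⟨X', rfl⟩ := exists_smoothField_apply_eq u'
  obtain ⟨Y, rfl⟩ := exists_smoothField_apply_eq v
  obtain ⟨Z, rfl⟩ := exists_smoothField_apply_eq w
  have h := hc.curvature_apply (X + X') Y Z x
  rw [curv_add_left] at h
  simpa [hc.curvature_apply] using h

include hc in
lemma curvature_smul_left [T2Space M] (x : M) (a : ℝ) (u v w : TangentSpace I x) :
    curvature cov x (a • u) v w = a • curvature cov x u v w := by
  obtain ⟨X, rfl⟩ := exists_smoothField_apply_eq u
  obtain ⟨Y, rfl⟩ := exists_smoothField_apply_eq v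
  obtain ⟨Z, rfl⟩ := exists_smoothField_apply_eq w
  have ha : (ContMDiffMap.const a : SmoothFun I M) x = a := rfl
  have h := hc.curvature_apply ((ContMDiffMap.const a : SmoothFun I M) • X) Y Z x
  rw [curv_fun_smul_left] at h
  simpa [hc.curvature_apply, ha] using h

include hc in
lemma curvature_add_right [T2Space M] (x : M) (u v w w' : TangentSpace I x) :
    curvature cov x u v (w + w') = curvature cov x u v w + curvature cov x u v w' := by
  obtain ⟨X, rfl⟩ := exists_smoothField_apply_eq u
  obtain ⟨Y, rfl⟩ := exists_smoothField_apply_eq v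
  obtain ⟨Z, rfl⟩ := exists_smoothField_apply_eq w
  obtain ⟨Z', rfl⟩ := exists_smoothField_apply_eq w'
  have h := hc.curvature_apply X Y (Z + Z') x
  rw [curv_add_right] at h
  simpa [hc.curvature_apply] using h

include hc in
lemma curvature_smul_right [T2Space M] (x : M) (a : ℝ) (u v w : TangentSpace I x) :
    curvature cov x u v (a • w) = a • curvature cov x u v w := by
  obtain ⟨X, rfl⟩ := exists_smoothField_apply_eq u
  obtain ⟨Y, rfl⟩ := exists_smoothField_apply_eq v
  obtain ⟨Z, rfl⟩ := exists_smoothField_apply_eq w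
  have ha : (ContMDiffMap.const a : SmoothFun I M) x = a := rfl
  have h := hc.curvature_apply X Y ((ContMDiffMap.const a : SmoothFun I M) • Z) x
  rw [curv_fun_smul_right] at h
  simpa [hc.curvature_apply, ha] using h

include hc in
lemma curvature_cyclic [T2Space M] (x : M) (u v w : TangentSpace I x) :
    curvature cov x u v w + curvature cov x v w u + curvature cov x w u v = 0 := by
  obtain ⟨X, rfl⟩ := exists_smoothField_apply_eq u
  obtain ⟨Y, rfl⟩ := exists_smoothField_apply_eq v
  obtain ⟨Z, rfl⟩ := exists_smoothField_apply_eq w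
  simp only [hc.curvature_apply]
  exact congrArg (fun W : SmoothField I M ↦ W x) (hc.curv_cyclic X Y Z)

/-- The curvature tensor at a point, as a trilinear map. -/
def curvatureTensor [T2Space M] (hc : IsLeviCivita cov) (x : M) :
    TangentSpace I x →ₗ[ℝ] TangentSpace I x →ₗ[ℝ] TangentSpace I x →ₗ[ℝ] TangentSpace I x :=
  LinearMap.mk₂ ℝ (fun u v ↦
    { toFun := curvature cov x u v
      map_add' := hc.curvature_add_right x u v
      map_smul' := fun a ↦ hc.curvature_smul_right x a u v })
    (fun u u' v ↦ LinearMap.ext (hc.curvature_add_left x u u' v))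
    (fun a u v ↦ LinearMap.ext (hc.curvature_smul_left x a u v))
    (fun u v v' ↦ LinearMap.ext fun w ↦ by
      simp only [LinearMap.coe_mk, AddHom.coe_mk, LinearMap.add_apply]
      rw [hc.curvature_swap, hc.curvature_add_left, hc.curvature_swap x u v,
        hc.curvature_swap x u v', neg_add, neg_neg, neg_neg])
    (fun a u v ↦ LinearMap.ext fun w ↦ by
      simp only [LinearMap.coe_mk, AddHom.coe_mk, LinearMap.smul_apply]
      rw [hc.curvature_swap, hc.curvature_smul_left, hc.curvature_swap x u v,
        smul_neg, neg_neg])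

lemma curvatureTensor_apply [T2Space M] (x : M) (u v w : TangentSpace I x) :
    hc.curvatureTensor x u v w = curvature cov x u v w := rfl

end IsLeviCivita

variable [IsContMDiffRiemannianBundle I ∞ E (fun x : M ↦ TangentSpace I x)]

/-- The pointwise inner product of smooth vector fields, as a smooth function. -/
def SmoothField.inn (X Y : SmoothField I M) : SmoothFun I M :=
  ⟨fun x ↦ inner ℝ (X x) (Y x), ContMDiff.inner_bundle (E := fun x : M ↦ TangentSpace I x)
    (b := fun x ↦ x) (v := X) (w := Y) X.contMDiff Y.contMDiff⟩

@[simp]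
lemma SmoothField.inn_apply (X Y : SmoothField I M) (x : M) :
    X.inn Y x = inner ℝ (X x) (Y x) := rfl

namespace IsLeviCivita

variable (hc : IsLeviCivita cov)

lemma deriv_inn (X Y Z : SmoothField I M) :
    X.deriv (Y.inn Z) = (hc.nabla X Y).inn Z + Y.inn (hc.nabla X Z) := by
  ext x
  exact hc.metric x (X x) Y Z (Y.mdiffAt x) (Z.mdiffAt x)

/-- Apply `[X,Y] = XY - YX` to the function `⟨Z, W⟩` and expand by metric compatibility; the mixed
first-order terms cancel. -/
lemma inn_curv [T2Space M] (X Y Z W : SmoothField I M) :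
    (hc.curv X Y Z).inn W = - Z.inn (hc.curv X Y W) := by
  have h := hc.deriv_bracket X Y (Z.inn W)
  simp only [hc.deriv_inn, SmoothField.deriv_add] at h
  ext x
  have h := congrArg (fun f : SmoothFun I M ↦ f x) h
  simp only [ContMDiffMap.coe_add, ContMDiffMap.coe_sub, ContMDiffMap.coe_neg, Pi.add_apply,
    Pi.sub_apply, Pi.neg_apply, SmoothField.inn_apply, curv, ContMDiffSection.coe_sub,
    inner_sub_left, inner_sub_right] at h ⊢
  linarith

include hc in
lemma inner_curvature [T2Space M] (x : M) (u v w z : TangentSpace I x) :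
    inner ℝ (curvature cov x u v w) z = - inner ℝ w (curvature cov x u v z) := by
  obtain ⟨X, rfl⟩ := exists_smoothField_apply_eq u
  obtain ⟨Y, rfl⟩ := exists_smoothField_apply_eq v
  obtain ⟨Z, rfl⟩ := exists_smoothField_apply_eq w
  obtain ⟨W, rfl⟩ := exists_smoothField_apply_eq z
  simp only [hc.curvature_apply]
  exact congrArg (fun f : SmoothFun I M ↦ f x) (hc.inn_curv X Y Z W)

end IsLeviCivita

end Metric

/-! ### Linear algebra of curvature tensors -/

section AlgebraicCurvature

variable {V : Type*} [NormedAddCommGroup V] [InnerProductSpace ℝ V]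

/-- The algebraic symmetries of a Riemannian curvature tensor on an inner product space. -/
structure IsAlgebraicCurvature (R : V →ₗ[ℝ] V →ₗ[ℝ] V →ₗ[ℝ] V) : Prop where
  swap : ∀ u v w, R v u w = -R u v w
  skew : ∀ u v w z, inner ℝ (R u v w) z = -inner ℝ w (R u v z)
  cyclic : ∀ u v w, R u v w + R v w u + R w u v = 0

/-- The endomorphism `u ↦ R(u, v) w`. -/
def jacobiMap (R : V →ₗ[ℝ] V →ₗ[ℝ] V →ₗ[ℝ] V) (v w : V) : V →ₗ[ℝ] V :=
  (R.flip v).flip w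

@[simp]
lemma jacobiMap_apply (R : V →ₗ[ℝ] V →ₗ[ℝ] V →ₗ[ℝ] V) (u v w : V) :
    jacobiMap R v w u = R u v w := rfl

/-- The Ricci contraction of a curvature-like tensor. -/
def ricciForm (R : V →ₗ[ℝ] V →ₗ[ℝ] V →ₗ[ℝ] V) (v w : V) : ℝ :=
  LinearMap.trace ℝ V (jacobiMap R v w)

variable {R : V →ₗ[ℝ] V →ₗ[ℝ] V →ₗ[ℝ] V}

lemma ricciForm_eq_sum {ι : Type*} [Fintype ι] (b : OrthonormalBasis ι ℝ V) (v w : V) :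
    ricciForm R v w = ∑ i, inner ℝ (R (b i) v w) (b i) := by
  rw [ricciForm, LinearMap.trace_eq_sum_inner _ b]
  exact Finset.sum_congr rfl fun i _ ↦ real_inner_comm _ _

lemma ricciForm_sub_right (v w w' : V) :
    ricciForm R v (w - w') = ricciForm R v w - ricciForm R v w' := by
  rw [ricciForm, ricciForm, ricciForm, ← map_sub]
  congr 1
  ext u
  simp

lemma ricciForm_smul_right (a : ℝ) (v w : V) : ricciForm R v (a • w) = a * ricciForm R v w := by
  rw [ricciForm, ricciForm, ← smul_eq_mul, ← map_smul]
  congr 1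
  ext u
  simp

/-- A semisymmetric curvature tensor is Ricci-semisymmetric. -/
lemma ricciForm_add_ricciForm_eq_zero {u v : V}
    (h : ∀ a b c, R u v (R a b c) - R (R u v a) b c - R a (R u v b) c - R a b (R u v c) = 0)
    (a b : V) : ricciForm R (R u v a) b + ricciForm R a (R u v b) = 0 := by
  -- The derivation property says that `R(u,v)` acts on `jacobiMap R a b` by a commutator, which has
  -- trace zero.
  have h1 : jacobiMap R (R u v a) b + jacobiMap R a (R u v b)
      = R u v * jacobiMap R a b - jacobiMap R a b * R u v := by
    ext c
    have := h c a b
    simp only [LinearMap.add_apply, jacobiMap_apply, LinearMap.sub_apply, Module.End.mul_apply]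
    rw [← sub_eq_zero, ← neg_eq_zero, ← this]
    abel
  rw [ricciForm, ricciForm, ← map_add, h1, map_sub, LinearMap.trace_mul_comm, sub_self]

namespace IsAlgebraicCurvature

variable (hR : IsAlgebraicCurvature R)

include hR in
lemma pair_symm (u v w z : V) : inner ℝ (R u v w) z = inner ℝ (R w z u) v := by
  have c (a b c d : V) : inner ℝ (R a b c) d + inner ℝ (R b c a) d + inner ℝ (R c a b) d = 0 := by
    rw [← inner_add_left, ← inner_add_left, hR.cyclic, inner_zero_left]
  have s (a b c d : V) : inner ℝ (R b a c) d = -inner ℝ (R a b c) d := by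
    rw [hR.swap, inner_neg_left]
  have t (a b c d : V) : inner ℝ (R a b c) d = -inner ℝ (R a b d) c := by
    rw [hR.skew, real_inner_comm]
  -- Four cyclic identities, each with a different vector in the last slot; the rest are sign
  -- changes.
  linarith [c u v w z, c v w z u, c w z u v, c z u v w, s u v w z, s u w v z, s u z v w,
    s v w u z, s v z u w, s w z u v, t u v w z, t u w v z, t u z v w, t v w u z, t v z u w,
    t w z u v, s w z v u, s v z w u, s v w z u, s u z w v, s u w z v, s u v z w, t w u v z,
    t z u w v, t z v w u, t w v u z, t v u w z, t z w u v]

variable {ξ : V} {k : ℝ}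

include hR in
-- Pair symmetry turns `⟨R(ξ,v)w, z⟩` into `⟨R(w,z)ξ, v⟩`, which the hypothesis evaluates.
lemma apply_of_apply_right (hk : ∀ u v, R u v ξ = k • (inner ℝ u ξ • v - inner ℝ v ξ • u))
    (v w : V) : R ξ v w = k • (inner ℝ w ξ • v - inner ℝ v w • ξ) := by
  refine ext_inner_right ℝ fun z ↦ ?_
  rw [hR.pair_symm, hk]
  simp only [inner_smul_left, inner_sub_left, RCLike.conj_to_real]
  rw [real_inner_comm v z, real_inner_comm v w, real_inner_comm z ξ]
  ring

variable [FiniteDimensional ℝ V]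

/-- In the factor `1 - finrank`, the `1` is Parseval applied to `⟨v, ξ⟩` and the dimension counts
the unit basis vectors. -/
lemma ricciForm_right (hk : ∀ u v, R u v ξ = k • (inner ℝ u ξ • v - inner ℝ v ξ • u)) (v : V) :
    ricciForm R v ξ = (1 - Module.finrank ℝ V) * k * inner ℝ v ξ := by
  have h := (stdOrthonormalBasis ℝ V).sum_inner_mul_inner v ξ
  rw [ricciForm_eq_sum (stdOrthonormalBasis ℝ V)]
  simp only [hk, inner_smul_left, inner_sub_left, RCLike.conj_to_real,
    real_inner_self_eq_norm_sq, OrthonormalBasis.norm_eq_one, mul_sub, Finset.sum_sub_distrib,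
    ← Finset.mul_sum]
  have h' : ∑ i, inner ℝ (stdOrthonormalBasis ℝ V i) ξ * inner ℝ v (stdOrthonormalBasis ℝ V i)
      = inner ℝ v ξ := by
    rw [← h]; exact Finset.sum_congr rfl fun i _ ↦ mul_comm _ _
  simp [h']
  ring

include hR in
/-- The Ricci-semisymmetry condition forces the Ricci form to be a multiple of the inner product
when the curvature in the direction of `ξ` is that of a space of constant curvature. -/
lemma ricciForm_eq_of_ricciSemisymmetric (hξ : inner ℝ ξ ξ = (1 : ℝ)) (hk0 : k ≠ 0)
    (hk : ∀ u v, R u v ξ = k • (inner ℝ u ξ • v - inner ℝ v ξ • u))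
    (h : ∀ u v a b, ricciForm R (R u v a) b + ricciForm R a (R u v b) = 0) (v w : V) :
    ricciForm R v w = (1 - Module.finrank ℝ V) * k * inner ℝ v w := by
  -- With `ξ` in the first and last slots only `S(v,w)` stays unknown; the terms in `k² ⟨v,ξ⟩⟨w,ξ⟩`
  -- cancel.
  have h1 := h ξ w v ξ
  rw [ricciForm_right hk, hR.apply_of_apply_right hk, hR.apply_of_apply_right hk,
    ricciForm_smul_right, ricciForm_sub_right, ricciForm_smul_right, ricciForm_smul_right,
    ricciForm_right hk, hξ] at h1
  simp only [inner_smul_left, inner_sub_left, RCLike.conj_to_real, hξ] at h1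
  rw [real_inner_comm v w] at h1
  refine mul_left_cancel₀ hk0 ?_
  linarith

end IsAlgebraicCurvature

end AlgebraicCurvature

/-- With `w` the derivative of an orthonormal frame, this says that a trace may be differentiated as
if the frame were parallel. After exchanging indices in one double sum, each matrix entry of `L` has
the coefficient in `hw`. -/
lemma sum_inner_skew_eq_zero {V ι : Type*} [NormedAddCommGroup V] [InnerProductSpace ℝ V]
    [Fintype ι] (b : OrthonormalBasis ι ℝ V) (L : V →ₗ[ℝ] V) (w : ι → V)
    (hw : ∀ i j, inner ℝ (w i) (b j) + inner ℝ (b i) (w j) = 0) :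
    ∑ i, (inner ℝ (L (w i)) (b i) + inner ℝ (L (b i)) (w i)) = 0 := by
  have h1 (i) : inner ℝ (L (w i)) (b i) = ∑ j, inner ℝ (b j) (w i) * inner ℝ (L (b j)) (b i) := by
    conv_lhs => rw [← b.sum_repr' (w i)]
    simp [sum_inner, inner_smul_left]
  have h2 (i) : inner ℝ (L (b i)) (w i) = ∑ j, inner ℝ (b j) (w i) * inner ℝ (L (b i)) (b j) := by
    conv_lhs => rw [← b.sum_repr' (w i)]
    simp [inner_sum, inner_smul_right]
  rw [Finset.sum_add_distrib, Finset.sum_congr rfl fun i _ ↦ h1 i, Finset.sum_comm,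
    ← Finset.sum_add_distrib]
  refine Finset.sum_eq_zero fun i _ ↦ ?_
  rw [h2, ← Finset.sum_add_distrib]
  refine Finset.sum_eq_zero fun j _ ↦ ?_
  rw [← add_mul, real_inner_comm (w i) (b j), add_comm, hw, zero_mul]

/-! ### Orthonormal frames and the tensor `∇R` -/

section Schur

variable {E : Type*} [NormedAddCommGroup E] [NormedSpace ℝ E] [FiniteDimensional ℝ E]
  {H : Type*} [TopologicalSpace H] {I : ModelWithCorners ℝ E H}
  {M : Type*} [TopologicalSpace M] [ChartedSpace H M] [IsManifold I ∞ M]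
  [RiemannianBundle (fun x : M ↦ TangentSpace I x)]
  [IsContMDiffRiemannianBundle I ∞ E (fun x : M ↦ TangentSpace I x)]
  {cov : CovariantDerivative I E (TangentSpace I : M → Type _)}

lemma contMDiffOn_inner {u : Set M} {X Y : Π x : M, TangentSpace I x}
    (hX : CMDiff[u] ∞ (T% X)) (hY : CMDiff[u] ∞ (T% Y)) :
    ContMDiffOn I 𝓘(ℝ, ℝ) ∞ (fun x ↦ (inner ℝ (X x) (Y x) : ℝ)) u :=
  ContMDiffOn.inner_bundle (E := fun x : M ↦ TangentSpace I x)
    (b := fun x ↦ x) (v := X) (w := Y) hX hY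

/-- Strong induction along the Gram–Schmidt recursion; linear independence keeps its denominators
nonzero. -/
lemma contMDiffOn_gramSchmidt {m : ℕ} {u : Set M} {s : Fin m → Π x : M, TangentSpace I x}
    (hs : ∀ i, CMDiff[u] ∞ (T% (s i))) (hli : ∀ x ∈ u, LinearIndependent ℝ (s · x)) (k : Fin m) :
    CMDiff[u] ∞ (T% (fun x ↦ InnerProductSpace.gramSchmidt ℝ (s · x) k)) := by
  induction k using WellFoundedLT.induction with
  | ind k ih =>
    have h (i : Fin m) (hi : i < k) : ContMDiffOn I 𝓘(ℝ, ℝ) ∞ (fun x ↦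
        inner ℝ (InnerProductSpace.gramSchmidt ℝ (s · x) i) (s k x) /
          inner ℝ (InnerProductSpace.gramSchmidt ℝ (s · x) i)
            (InnerProductSpace.gramSchmidt ℝ (s · x) i)) u :=
      (contMDiffOn_inner (ih i hi) (hs k)).div₀ (contMDiffOn_inner (ih i hi) (ih i hi))
        fun x hx ↦ inner_self_ne_zero.mpr
          (InnerProductSpace.gramSchmidt_ne_zero i (hli x hx))
    have h' := (hs k).sub_section (ContMDiffOn.sum_section (s := Finset.Iio k)
      fun i hi ↦ (h i (Finset.mem_Iio.mp hi)).smul_section (ih i (Finset.mem_Iio.mp hi)))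
    refine h'.congr fun x hx ↦ ?_
    rw [InnerProductSpace.gramSchmidt_def]
    simp [Submodule.starProjection_singleton]

lemma contMDiffOn_gramSchmidtNormed {m : ℕ} {u : Set M} {s : Fin m → Π x : M, TangentSpace I x}
    (hs : ∀ i, CMDiff[u] ∞ (T% (s i))) (hli : ∀ x ∈ u, LinearIndependent ℝ (s · x)) (k : Fin m) :
    CMDiff[u] ∞ (T% (fun x ↦ InnerProductSpace.gramSchmidtNormed ℝ (s · x) k)) := by
  have h := contMDiffOn_gramSchmidt hs hli k
  have h1 : ContMDiffOn I 𝓘(ℝ, ℝ) ∞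
      (fun x ↦ ‖InnerProductSpace.gramSchmidt ℝ (s · x) k‖⁻¹) u := by
    refine ContMDiffOn.inv₀ ?_ fun x hx ↦
      norm_ne_zero_iff.mpr (InnerProductSpace.gramSchmidt_ne_zero k (hli x hx))
    intro x hx
    have h2 : inner ℝ (InnerProductSpace.gramSchmidt ℝ (s · x) k)
        (InnerProductSpace.gramSchmidt ℝ (s · x) k) ≠ (0 : ℝ) :=
      inner_self_ne_zero.mpr (InnerProductSpace.gramSchmidt_ne_zero k (hli x hx))
    have h3 := (Real.contDiffAt_sqrt (n := ∞) h2).contMDiffAt.comp_contMDiffWithinAt x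
      (contMDiffOn_inner h h x hx)
    refine h3.congr (fun y _ ↦ ?_) ?_ <;> exact norm_eq_sqrt_real_inner _
  exact h1.smul_section h

/-- Around each point there is a local orthonormal frame, made of globally smooth fields. -/
lemma exists_orthonormal_frame [T2Space M] (x : M) :
    ∃ e : Fin (Module.finrank ℝ E) → SmoothField I M,
      ∀ᶠ y in 𝓝 x, Orthonormal ℝ (fun i ↦ e i y) := by
  let t := trivializationAt E (TangentSpace I : M → Type _) x
  have hx : t.baseSet ∈ 𝓝 x :=
    t.open_baseSet.mem_nhds (FiberBundle.mem_baseSet_trivializationAt E _ x)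
  let b := Module.finBasis ℝ E
  have hf := t.isLocalFrameOn_localFrame_baseSet I ∞ b
  have hs := contMDiffOn_gramSchmidtNormed hf.contMDiffOn fun y hy ↦ hf.linearIndependent hy
  choose e he using fun k ↦ exists_smoothField_eventuallyEq hx (hs k)
  refine ⟨e, ?_⟩
  filter_upwards [eventually_all.mpr he, hx] with y hy hy'
  have : (fun i ↦ e i y) = InnerProductSpace.gramSchmidtNormed ℝ (t.localFrame b · y) :=
    funext hy
  rw [this]
  exact InnerProductSpace.gramSchmidtNormed_orthonormal (hf.linearIndependent hy')

lemma exists_orthonormalBasis_coe_eq {x : M}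
    {v : Fin (Module.finrank ℝ E) → TangentSpace I x} (hv : Orthonormal ℝ v) :
    ∃ b : OrthonormalBasis (Fin (Module.finrank ℝ E)) ℝ (TangentSpace I x), ∀ i, b i = v i := by
  have h : Submodule.span ℝ (Set.range v) = ⊤ :=
    hv.linearIndependent.span_eq_top_of_card_eq_finrank' (by
      rw [Fintype.card_fin]; rfl)
  exact ⟨OrthonormalBasis.mk hv h.ge, fun i ↦ by simp⟩

namespace IsLeviCivita

variable (hc : IsLeviCivita cov)

include hc in
lemma ricci_eq_ricciForm [T2Space M] (x : M) (v w : TangentSpace I x) :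
    ricci cov x v w = ricciForm (hc.curvatureTensor x) v w := by
  rw [ricciForm_eq_sum (stdOrthonormalBasis ℝ (TangentSpace I x))]
  rfl

lemma isAlgebraicCurvature [T2Space M] (x : M) : IsAlgebraicCurvature (hc.curvatureTensor x) where
  swap := hc.curvature_swap x
  skew := hc.inner_curvature x
  cyclic := hc.curvature_cyclic x

/-- The field `(∇_Z R)(X, Y) U`. -/
def nablaCurv (Z X Y U : SmoothField I M) : SmoothField I M :=
  hc.nabla Z (hc.curv X Y U) - hc.curv (hc.nabla Z X) Y U - hc.curv X (hc.nabla Z Y) U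
    - hc.curv X Y (hc.nabla Z U)

lemma nablaCurv_swap (Z X Y U : SmoothField I M) :
    hc.nablaCurv Z Y X U = -hc.nablaCurv Z X Y U := by
  have h : hc.nabla Z (-hc.curv X Y U) = -hc.nabla Z (hc.curv X Y U) :=
    map_neg (hc.nablaHom Z) _
  simp only [nablaCurv, hc.curv_swap X Y, hc.curv_swap (hc.nabla Z X) Y,
    hc.curv_swap X (hc.nabla Z Y), h]
  abel

/-- The second Bianchi identity in tensor form: splitting `[X,Y]` as `∇_X Y - ∇_Y X` produces
exactly the correction terms in `nablaCurv`. -/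
lemma nablaCurv_cyclic (X Y Z U : SmoothField I M) :
    hc.nablaCurv Z X Y U + hc.nablaCurv X Y Z U + hc.nablaCurv Y Z X U = 0 := by
  have h (X Y Z : SmoothField I M) : hc.curv (hc.bracket X Y) Z U
      = hc.curv (hc.nabla X Y) Z U + hc.curv Z (hc.nabla Y X) U := by
    have h1 : hc.nabla X Y = hc.bracket X Y + hc.nabla Y X := by simp [bracket]
    conv_rhs => rw [h1, curv_add_left, hc.curv_swap (hc.nabla Y X) Z]
    abel
  have h2 := hc.nabla_curv_cyclic X Y Z U
  simp only [h] at h2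
  simp only [nablaCurv]
  rw [← sub_eq_zero] at h2
  rw [← h2]
  abel

/-- Obtained by differentiating the skew-symmetry `inn_curv` along `Z`. -/
lemma inn_nablaCurv [T2Space M] (Z X Y U V : SmoothField I M) (x : M) :
    (inner ℝ (hc.nablaCurv Z X Y U x) (V x) : ℝ) = -inner ℝ (hc.nablaCurv Z X Y V x) (U x) := by
  have key (X Y U V : SmoothField I M) :
      (inner ℝ (hc.curv X Y U x) (V x) : ℝ) = -inner ℝ (hc.curv X Y V x) (U x) := by
    rw [real_inner_comm (U x)]
    exact congrArg (fun f : SmoothFun I M ↦ f x) (hc.inn_curv X Y U V)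
  have h : Z.deriv ((hc.curv X Y U).inn V) + Z.deriv (U.inn (hc.curv X Y V)) = 0 := by
    rw [← SmoothField.deriv_add, hc.inn_curv, neg_add_cancel]
    ext y
    exact congrArg (fun L : TangentSpace I y →L[ℝ] ℝ ↦ L (Z y)) mvfderiv_zero
  rw [hc.deriv_inn, hc.deriv_inn] at h
  have h := congrArg (fun f : SmoothFun I M ↦ f x) h
  simp only [ContMDiffMap.coe_add, Pi.add_apply, SmoothField.inn_apply,
    ContMDiffMap.coe_zero, Pi.zero_apply] at h
  simp only [nablaCurv, ContMDiffSection.coe_sub, Pi.sub_apply, inner_sub_left]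
  have h1 := key (hc.nabla Z X) Y U V
  have h2 := key X (hc.nabla Z Y) U V
  have h3 := key X Y (hc.nabla Z U) V
  have h4 := key X Y U (hc.nabla Z V)
  rw [real_inner_comm (hc.nabla Z (hc.curv X Y V) x) (U x),
    real_inner_comm (hc.curv X Y V x) (hc.nabla Z U x)] at h
  linarith

end IsLeviCivita

end Schur

/-! ### Schur's lemma -/

section Schur

variable {E : Type*} [NormedAddCommGroup E] [NormedSpace ℝ E] [FiniteDimensional ℝ E]
  {H : Type*} [TopologicalSpace H] {I : ModelWithCorners ℝ E H}
  {M : Type*} [TopologicalSpace M] [ChartedSpace H M] [IsManifold I ∞ M]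
  [RiemannianBundle (fun x : M ↦ TangentSpace I x)]
  [IsContMDiffRiemannianBundle I ∞ E (fun x : M ↦ TangentSpace I x)]
  {cov : CovariantDerivative I E (TangentSpace I : M → Type _)}

lemma SmoothField.deriv_mul (X : SmoothField I M) (f g : SmoothFun I M) :
    X.deriv (f * g) = f * X.deriv g + g * X.deriv f := by
  ext x
  simp [mvfderiv_mul (f.mdiffAt x) (g.mdiffAt x)]

lemma SmoothField.deriv_sum {ι : Type*} (s : Finset ι) (X : SmoothField I M)
    (f : ι → SmoothFun I M) : X.deriv (∑ i ∈ s, f i) = ∑ i ∈ s, X.deriv (f i) :=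
  map_sum (AddMonoidHom.mk' X.deriv X.deriv_add) f s

lemma SmoothFun.sum_apply {ι : Type*} (s : Finset ι) (f : ι → SmoothFun I M) (x : M) :
    (∑ i ∈ s, f i) x = ∑ i ∈ s, f i x :=
  map_sum (AddMonoidHom.mk' (fun f : SmoothFun I M ↦ f x) fun _ _ ↦ rfl) f s

lemma mvfderiv_congr_of_eventuallyEq {f g : M → ℝ} {x : M} (h : ∀ᶠ y in 𝓝 x, f y = g y)
    (u : TangentSpace I x) : d% f x u = d% g x u := by
  have h1 := Filter.EventuallyEq.mfderiv_eq (I := I) (I' := 𝓘(ℝ, ℝ)) (x := x) (f₁ := f) (f := g) h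
  simp only [mvfderiv]
  exact congrArg (fun L : TangentSpace I x →L[ℝ] ℝ ↦ L u) h1

namespace IsLeviCivita

variable (hc : IsLeviCivita cov)

/-- Contracting `∇R` when the Ricci tensor is a multiple of the metric. -/
lemma sum_inner_nablaCurv [T2Space M] {h : SmoothFun I M}
    (hS : ∀ (x : M) (v w : TangentSpace I x), ricci cov x v w = h x * inner ℝ v w) {x : M}
    {e : Fin (Module.finrank ℝ E) → SmoothField I M}
    (he : ∀ᶠ y in 𝓝 x, Orthonormal ℝ (fun i ↦ e i y)) (Z Y U : SmoothField I M) :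
    ∑ i, (inner ℝ (hc.nablaCurv Z (e i) Y U x) (e i x) : ℝ)
      = Z.deriv h x * inner ℝ (Y x) (U x) := by
  have hsum {y : M} (hy : Orthonormal ℝ (fun i ↦ e i y)) (Y U : SmoothField I M) :
      ∑ i, (inner ℝ (hc.curv (e i) Y U y) (e i y) : ℝ) = h y * inner ℝ (Y y) (U y) := by
    obtain ⟨b, hb⟩ := exists_orthonormalBasis_coe_eq hy
    rw [← hS, hc.ricci_eq_ricciForm, ricciForm_eq_sum b]
    refine Finset.sum_congr rfl fun i _ ↦ ?_
    rw [hc.curvatureTensor_apply, hb, hc.curvature_apply]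
  -- The frame is orthonormal on a neighbourhood, so the trace formula for `S` can be differentiated
  -- at `x`.
  have hder : Z.deriv (∑ i, (hc.curv (e i) Y U).inn (e i)) x = Z.deriv (h * Y.inn U) x := by
    refine mvfderiv_congr_of_eventuallyEq ?_ (Z x)
    filter_upwards [he] with y hy
    rw [SmoothFun.sum_apply]
    exact hsum hy Y U
  rw [SmoothField.deriv_sum, SmoothField.deriv_mul, SmoothFun.sum_apply] at hder
  simp only [hc.deriv_inn, ContMDiffMap.coe_add, ContMDiffMap.coe_mul, Pi.add_apply, Pi.mul_apply,
    SmoothField.inn_apply, Finset.sum_add_distrib] at hder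
  obtain ⟨b, hb⟩ := exists_orthonormalBasis_coe_eq he.self_of_nhds
  -- The derivatives of the frame contribute nothing: `⟨e i, e j⟩` is locally constant, so their
  -- coefficients are skew.
  have hskew : ∑ i, ((inner ℝ (hc.curv (hc.nabla Z (e i)) Y U x) (e i x) : ℝ)
      + inner ℝ (hc.curv (e i) Y U x) (hc.nabla Z (e i) x)) = 0 := by
    have := sum_inner_skew_eq_zero b (jacobiMap (hc.curvatureTensor x) (Y x) (U x))
      (fun i ↦ hc.nabla Z (e i) x) fun i j ↦ by
        rw [hb, hb]
        have h1 : Z.deriv ((e i).inn (e j)) x = 0 := by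
          have h2 := mvfderiv_congr_of_eventuallyEq (f := (e i).inn (e j))
            (g := fun _ ↦ if i = j then 1 else 0) (x := x) (by
              filter_upwards [he] with y hy
              exact orthonormal_iff_ite.mp hy i j) (Z x)
          rw [mvfderiv_const] at h2
          exact h2
        rw [hc.deriv_inn] at h1
        exact h1
    simpa only [jacobiMap_apply, hc.curvatureTensor_apply, hb, hc.curvature_apply] using this
  have h1 := hsum he.self_of_nhds (hc.nabla Z Y) U
  have h2 := hsum he.self_of_nhds Y (hc.nabla Z U)
  rw [Finset.sum_add_distrib] at hskew
  simp only [nablaCurv, ContMDiffSection.coe_sub, Pi.sub_apply, inner_sub_left,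
    Finset.sum_sub_distrib]
  linarith

include hc in
/-- Schur's lemma: a function `h` with `S = h g` is locally constant in dimension `≠ 2`. -/
lemma mvfderiv_eq_zero_of_ricci_eq [T2Space M] (hdim : Module.finrank ℝ E ≠ 2) {h : SmoothFun I M}
    (hS : ∀ (x : M) (v w : TangentSpace I x), ricci cov x v w = h x * inner ℝ v w) (x : M)
    (u : TangentSpace I x) : d% (h : M → ℝ) x u = 0 := by
  obtain ⟨e, he⟩ := exists_orthonormal_frame (I := I) x
  have hon := orthonormal_iff_ite.mp he.self_of_nhds
  have key (k) : (e k).deriv h x = 0 := by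
    -- Contract the second Bianchi identity twice. Its three terms give `N`, `-1` and `-1` times
    -- `e_k(h)`, where `N` is the dimension; the signs come from skewness in the last and in the
    -- first pair of slots.
    have h0 : ∑ j, ∑ i, (inner ℝ ((hc.nablaCurv (e k) (e i) (e j) (e j) +
        hc.nablaCurv (e i) (e j) (e k) (e j) + hc.nablaCurv (e j) (e k) (e i) (e j)) x)
        (e i x) : ℝ) = 0 := by
      simp [hc.nablaCurv_cyclic]
    have h1 : ∑ j, ∑ i, (inner ℝ (hc.nablaCurv (e k) (e i) (e j) (e j) x) (e i x) : ℝ)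
        = Module.finrank ℝ E * (e k).deriv h x := by
      simp only [hc.sum_inner_nablaCurv hS he, hon]
      simp
    have h2 : ∑ j, ∑ i, (inner ℝ (hc.nablaCurv (e j) (e k) (e i) (e j) x) (e i x) : ℝ)
        = -(e k).deriv h x := by
      have hsw (i j) := hc.nablaCurv_swap (e j) (e i) (e k) (e j)
      simp only [hsw, ContMDiffSection.coe_neg, Pi.neg_apply,
        inner_neg_left, Finset.sum_neg_distrib, hc.sum_inner_nablaCurv hS he, hon]
      simp
    have h3 : ∑ j, ∑ i, (inner ℝ (hc.nablaCurv (e i) (e j) (e k) (e j) x) (e i x) : ℝ)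
        = -(e k).deriv h x := by
      rw [Finset.sum_comm, Finset.sum_congr rfl fun i _ ↦ Finset.sum_congr rfl fun j _ ↦
        hc.inn_nablaCurv (e i) (e j) (e k) (e j) (e i) x]
      simp only [Finset.sum_neg_distrib,
        hc.sum_inner_nablaCurv hS he, hon]
      simp
    simp only [ContMDiffSection.coe_add, Pi.add_apply, inner_add_left, Finset.sum_add_distrib,
      h1, h2, h3] at h0
    have h4 : ((Module.finrank ℝ E : ℝ) - 2) * (e k).deriv h x = 0 := by linarith
    refine (mul_eq_zero.mp h4).resolve_left fun h5 ↦ hdim ?_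
    exact_mod_cast sub_eq_zero.mp h5
  obtain ⟨b, hb⟩ := exists_orthonormalBasis_coe_eq he.self_of_nhds
  rw [← b.sum_repr' u, map_sum]
  refine Finset.sum_eq_zero fun i _ ↦ ?_
  rw [map_smul, hb]
  exact (congrArg _ (key i)).trans (smul_zero _)

end IsLeviCivita

end Schur

/-! ### `f`-Kenmotsu manifolds and the conclusion -/

section Kenmotsu

variable {E : Type*} [NormedAddCommGroup E] [NormedSpace ℝ E] [FiniteDimensional ℝ E]
  {H : Type*} [TopologicalSpace H] {I : ModelWithCorners ℝ E H}
  {M : Type*} [TopologicalSpace M] [ChartedSpace H M] [IsManifold I ∞ M]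

lemma exists_eq_const_of_mvfderiv_eq_zero [I.Boundaryless] [ConnectedSpace M]
    (h : SmoothFun I M) (hd : ∀ (x : M) (u : TangentSpace I x), d% (h : M → ℝ) x u = 0) :
    ∃ c : ℝ, ∀ x, h x = c := by
  have hloc : IsLocallyConstant (h : M → ℝ) := by
    rw [IsLocallyConstant.iff_eventually_eq]
    intro x
    -- Absence of boundary puts a full ball inside the chart; on this convex set a vanishing
    -- derivative forces constancy.
    have ht : (extChartAt I x).target ∈ 𝓝 (extChartAt I x x) := extChartAt_target_mem_nhds x
    obtain ⟨r, hr, hball⟩ := Metric.mem_nhds_iff.mp ht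
    have hfd (z) (hz : z ∈ Metric.ball (extChartAt I x x) r) :
        HasFDerivAt ((h : M → ℝ) ∘ (extChartAt I x).symm) (0 : E →L[ℝ] ℝ) z := by
      have h1 := (contMDiffOn_extChartAt_symm (n := ∞) x).contMDiffAt
        (x := z) (extChartAt_target_mem_nhds' (hball hz))
      have h2 := (h.mdiffAt ((extChartAt I x).symm z)).hasMFDerivAt
      have h0 : mfderiv I 𝓘(ℝ, ℝ) (h : M → ℝ) ((extChartAt I x).symm z) = 0 :=
        ContinuousLinearMap.ext fun u ↦ hd _ u
      rw [h0] at h2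
      have h3 := h2.comp z (h1.mdifferentiableAt (by simp)).hasMFDerivAt
      rw [ContinuousLinearMap.zero_comp] at h3
      exact h3.hasFDerivAt
    have hU : (extChartAt I x) ⁻¹' Metric.ball (extChartAt I x x) r ∈ 𝓝 x :=
      (continuousAt_extChartAt x).preimage_mem_nhds (Metric.ball_mem_nhds _ hr)
    filter_upwards [hU, extChartAt_source_mem_nhds (I := I) x] with y hy hy'
    have := (convex_ball (extChartAt I x x) r).is_const_of_fderivWithin_eq_zero (𝕜 := ℝ)
      (f := (h : M → ℝ) ∘ (extChartAt I x).symm)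
      (fun z hz ↦ (hfd z hz).differentiableAt.differentiableWithinAt)
      (fun z hz ↦ (hfd z hz).hasFDerivWithinAt.fderivWithin
        (Metric.isOpen_ball.uniqueDiffWithinAt hz)) hy (Metric.mem_ball_self hr)
    rwa [Function.comp_apply, Function.comp_apply, (extChartAt I x).left_inv hy',
      (extChartAt I x).left_inv (mem_extChartAt_source x)] at this
  obtain ⟨x₀⟩ := (inferInstance : Nonempty M)
  exact ⟨h x₀, fun x ↦ hloc.apply_eq_of_isPreconnected isPreconnected_univ trivial trivial⟩

variable [RiemannianBundle (fun x : M ↦ TangentSpace I x)]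
  [IsContMDiffRiemannianBundle I ∞ E (fun x : M ↦ TangentSpace I x)]
  {cov : CovariantDerivative I E (TangentSpace I : M → Type _)}
  {φ : Π x : M, TangentSpace I x →L[ℝ] TangentSpace I x}
  {ξ : Π x : M, TangentSpace I x} {η : Π x : M, TangentSpace I x →L[ℝ] ℝ} {f : M → ℝ}

namespace IsFKenmotsu

variable (hM : IsFKenmotsu cov φ ξ η f)

include hM

lemma inner_xi_self (x : M) : inner ℝ (ξ x) (ξ x) = (1 : ℝ) := by
  rw [← hM.almostContact.eta_eq, hM.almostContact.eta_xi]

/-- Since `φ ξ = 0`, the structure equation at `Y = ξ` reads `φ(∇_u ξ) = f φ u`. Applying `φ` again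
determines `∇_u ξ` up to its `ξ`-component, which is zero because `ξ` has unit length. -/
lemma cov_xi (x : M) (u : TangentSpace I x) :
    cov ξ x u = f x • (u - (inner ℝ u (ξ x) : ℝ) • ξ x) := by
  have hξ : MDiffAt (T% ξ) x := (hM.almostContact.smooth_xi x).mdifferentiableAt (by simp)
  have h1 := hM.deriv_phi x u ξ hξ
  have h2 : (fun y ↦ φ y (ξ y)) = 0 := funext hM.almostContact.phi_xi
  rw [h2, ← hM.almostContact.eta_eq, hM.almostContact.eta_phi, hM.almostContact.eta_xi,
    CovariantDerivative.zero] at h1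
  have h3 : φ x (cov ξ x u) = f x • φ x u := by
    have h4 : -φ x (cov ξ x u) = f x • -φ x u := by simpa using h1
    rwa [smul_neg, neg_inj] at h4
  have h5 : inner ℝ (cov ξ x u) (ξ x) = (0 : ℝ) := by
    have h6 := hM.leviCivita.metric x u ξ ξ hξ hξ
    have h7 : (fun y ↦ (inner ℝ (ξ y) (ξ y) : ℝ)) = fun _ ↦ 1 := funext hM.inner_xi_self
    rw [h7, mvfderiv_const, real_inner_comm (cov ξ x u) (ξ x)] at h6
    have h8 : (0 : ℝ) = inner ℝ (cov ξ x u) (ξ x) + inner ℝ (cov ξ x u) (ξ x) := h6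
    linarith
  have h9 := congrArg (φ x) h3
  rw [map_smul, hM.almostContact.phi_phi, hM.almostContact.phi_phi, hM.almostContact.eta_eq,
    hM.almostContact.eta_eq, h5] at h9
  rw [← neg_inj, ← smul_neg, neg_sub, sub_eq_neg_add, ← h9]
  simp

lemma mvfderiv_eq (x : M) (u : TangentSpace I x) :
    d% f x u = d% f x (ξ x) * inner ℝ u (ξ x) := by
  have h := hM.df_wedge_eta x u (ξ x)
  rw [hM.almostContact.eta_xi, hM.almostContact.eta_eq] at h
  linarith

/-- Substitute `∇_X ξ = f (X - η(X) ξ)` twice: the iteration gives `f²`, and differentiating `f`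
gives `ξ(f)` because `df = ξ(f) η`. -/
lemma curvature_xi [T2Space M] (x : M) (u v : TangentSpace I x) :
    curvature cov x u v (ξ x) = (f x ^ 2 + d% f x (ξ x)) •
      ((inner ℝ u (ξ x) : ℝ) • v - (inner ℝ v (ξ x) : ℝ) • u) := by
  have hc := hM.leviCivita
  let Ξ : SmoothField I M := ⟨ξ, hM.almostContact.smooth_xi⟩
  let F : SmoothFun I M := ⟨f, hM.smooth_f⟩
  have hΞ (X : SmoothField I M) : hc.nabla X Ξ = F • (X - X.inn Ξ • Ξ) :=
    ContMDiffSection.ext fun y ↦ hM.cov_xi y (X y)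
  obtain ⟨X, rfl⟩ := exists_smoothField_apply_eq u
  obtain ⟨Y, rfl⟩ := exists_smoothField_apply_eq v
  have hd (X : SmoothField I M) : X.deriv F x = Ξ.deriv F x * inner ℝ (X x) (Ξ x) :=
    hM.mvfderiv_eq x (X x)
  have h1 : curvature cov x (X x) (Y x) (Ξ x) = (F x ^ 2 + Ξ.deriv F x) •
      ((inner ℝ (X x) (Ξ x) : ℝ) • Y x - (inner ℝ (Y x) (Ξ x) : ℝ) • X x) := by
    rw [hc.curvature_apply]
    simp only [IsLeviCivita.curv, hΞ, hc.nabla_fun_smul_right, hc.nabla_sub_right,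
      IsLeviCivita.bracket, hc.deriv_inn]
    simp only [ContMDiffSection.coe_sub, ContMDiffSection.coe_add, Pi.sub_apply, Pi.add_apply,
      coe_fun_smul, Pi.smul_apply', ContMDiffMap.coe_add, SmoothField.inn_apply, hd X, hd Y,
      inner_sub_left, inner_sub_right, inner_smul_right,
      real_inner_comm (Y x) (X x)]
    module
  exact h1

end IsFKenmotsu

namespace IsRegularFKenmotsu

variable (hM : IsRegularFKenmotsu cov φ ξ η f)

include hM

lemma ricci_eq [T2Space M] (h : IsRicciSemisymmetric cov) (x : M) (v w : TangentSpace I x) :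
    ricci cov x v w
      = (1 - Module.finrank ℝ E) * (f x ^ 2 + d% f x (ξ x)) * inner ℝ v w := by
  have hc := hM.leviCivita
  rw [hc.ricci_eq_ricciForm]
  refine (hc.isAlgebraicCurvature x).ricciForm_eq_of_ricciSemisymmetric
    (hM.inner_xi_self x) (hM.regular x) (hM.curvature_xi x) (fun u v a b ↦ ?_) v w
  have := h x u v a b
  simp only [curvatureActRicci, hc.ricci_eq_ricciForm] at this
  simp only [hc.curvatureTensor_apply]
  linarith

lemma isEinstein [T2Space M] [ConnectedSpace M] [I.Boundaryless] (hdim : Module.finrank ℝ E ≠ 2)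
    (h : IsRicciSemisymmetric cov) : IsEinstein cov := by
  let Ξ : SmoothField I M := ⟨ξ, hM.almostContact.smooth_xi⟩
  let F : SmoothFun I M := ⟨f, hM.smooth_f⟩
  let K : SmoothFun I M := (ContMDiffMap.const (1 - Module.finrank ℝ E : ℝ) : SmoothFun I M) *
    (F ^ 2 + Ξ.deriv F)
  have hS (x : M) (v w : TangentSpace I x) : ricci cov x v w = K x * inner ℝ v w :=
    hM.ricci_eq h x v w
  obtain ⟨c, hK⟩ := exists_eq_const_of_mvfderiv_eq_zero K
    (hM.leviCivita.mvfderiv_eq_zero_of_ricci_eq hdim hS)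
  exact ⟨c, fun x v w ↦ by rw [hS, hK]⟩

end IsRegularFKenmotsu

lemma IsSemisymmetric.isRicciSemisymmetric [T2Space M] (hc : IsLeviCivita cov)
    (h : IsSemisymmetric cov) : IsRicciSemisymmetric cov := by
  intro x u v a b
  have := ricciForm_add_ricciForm_eq_zero (R := hc.curvatureTensor x) (u := u) (v := v)
    (h x u v) a b
  simp only [curvatureActRicci, hc.ricci_eq_ricciForm]
  simp only [hc.curvatureTensor_apply] at this
  linarith

end Kenmotsu

end FKenmotsu

end

theorem proposition1 {n : ℕ}
    {M : Type*} [TopologicalSpace M] [T2Space M] [SecondCountableTopology M] [ConnectedSpace M]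
    [ChartedSpace (EuclideanSpace ℝ (Fin (2 * n + 1))) M] [IsManifold (𝓡 (2 * n + 1)) ∞ M]
    [RiemannianBundle (fun x : M ↦ TangentSpace (𝓡 (2 * n + 1)) x)]
    [IsContMDiffRiemannianBundle (𝓡 (2 * n + 1)) ∞ (EuclideanSpace ℝ (Fin (2 * n + 1)))
      (fun x : M ↦ TangentSpace (𝓡 (2 * n + 1)) x)]
    (cov : CovariantDerivative (𝓡 (2 * n + 1)) (EuclideanSpace ℝ (Fin (2 * n + 1)))
      (TangentSpace (𝓡 (2 * n + 1)) : M → Type _))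
    (φ : Π x : M, TangentSpace (𝓡 (2 * n + 1)) x →L[ℝ] TangentSpace (𝓡 (2 * n + 1)) x)
    (ξ : Π x : M, TangentSpace (𝓡 (2 * n + 1)) x)
    (η : Π x : M, TangentSpace (𝓡 (2 * n + 1)) x →L[ℝ] ℝ)
    (f : M → ℝ)
    (hM : FKenmotsu.IsRegularFKenmotsu cov φ ξ η f) :
    (FKenmotsu.IsRicciSemisymmetric cov → FKenmotsu.IsEinstein cov) ∧
    (FKenmotsu.IsSemisymmetric cov →
      FKenmotsu.IsRicciSemisymmetric cov ∧ FKenmotsu.IsEinstein cov) := by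
  -- Odd dimension avoids the one exceptional case of Schur's lemma; dimension one needs no separate
  -- argument.
  have hdim : Module.finrank ℝ (EuclideanSpace ℝ (Fin (2 * n + 1))) ≠ 2 := by
    rw [finrank_euclideanSpace_fin]; lia
  have hS (h : FKenmotsu.IsSemisymmetric cov) : FKenmotsu.IsRicciSemisymmetric cov :=
    h.isRicciSemisymmetric hM.leviCivita
  exact ⟨hM.isEinstein hdim, fun h ↦ ⟨hS h, hM.isEinstein hdim (hS h)⟩⟩
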